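/- Let $n$ be a positive integer and $k$ a non-negative integer, and put $$D_{n,k}=\det_{0\le i,j\le n-1}\left(\sum_{l=-k}^{k+1}\binom{2i+2j+2}{i+j+l+1}\right),$$ where $\binom{N}{m}=0$ if $m<0$ or $m>N$. Then, with $n_1$ denoting a non-negative integer, $$D_{n,k}=\begin{cases} (-1)^{n_1\binom{k+1}{2}}(2n_1+1), & \text{if } n=(k+1)n_1 \text{ and } k \text{ is even},\\ (-1)^{n_1\binom{k+1}{2}}, & \text{if } n=(k+1)n_1 \text{ and } k \text{ is odd},\\ (-1)^{n_1\binom{k+1}{2}}(4n_1+4), & \text{if } k\ge 1 \text{ and } n=(k+1)n_1+1,\\ (-1)^{(n_1+1)\binom{k+1}{2}+k}(4n_1+4), & \text{if } k\ge 1 \text{ and } n=(k+1)n_1+k,\\ 0, & \text{if } n\not\equiv 0,1,k \pmod{k+1}. \end{cases}$$ (For $k=1$ the third and fourth cases coincide and give the same value.) -/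

import Mathlib

/-- The binomial coefficient with a natural upper index and an arbitrary integer lower index `m`;
it is zero when `m < 0` (and, as for `Nat.choose`, when `m > N`). -/
def intBinom (N : ℕ) (m : ℤ) : ℤ :=
  if 0 ≤ m then (N.choose m.toNat : ℤ) else 0

/-- The `n × n` matrix, with rows and columns numbered from `0` to `n - 1`, whose `(i, j)` entry is
the sum of `binom (2i + 2j + 2) (i + j + l + 1)` over the integers `l` with `-k ≤ l ≤ k + 1`. -/
noncomputable def binomSumHankel (k n : ℕ) : Matrix (Fin n) (Fin n) ℤ :=
  Matrix.of fun i j =>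
    ∑ l ∈ Finset.Icc (-(k : ℤ)) ((k : ℤ) + 1),
      intBinom (2 * (i : ℕ) + 2 * (j : ℕ) + 2) (((i : ℕ) : ℤ) + ((j : ℕ) : ℤ) + l + 1)

/-! Put N = k + 1. Since x + 2 + x⁻¹ = x⁻¹(1 + x)², the entries are the moments, at powers of X + 2,
of the functional L(p) = CT[(x^(1-N) + ... + x^N)(x + x⁻¹ + 2) p(x + x⁻¹)]. Hence rows and columns
may be indexed by any monic bases.

The key relation is L((X - 2)p) = s((X + 2)p) with s = `skewTerm N`
(`hankelFunctional_X_sub_two_mul`). For s the composed Chebyshev polynomials S_a(C_N) are adapted: a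
factor S_a(C_N) turns the weight exponent N into N(a + 1) (`skewTerm_chebS_mul`), so s(S_a(C_N) q) =
0 once deg q + 1 < N(a + 1). In the basis S_a(C_N) X^i with i < N, the moments of s form diagonal
blocks, each antitriangular with -1 on its antidiagonal.

Trading X - 2 for X + 2 costs two bordering rows: evaluation at -2 and the constant term against
x^(1-N) + ... + x^N (`det_hankelFunctional_eq_border`). For n ≡ 0, 1, k mod N, adapting one column
to these rows leaves signs and a value coming from S_a(±2) = (±1)^a (a + 1), the source of the
linear factors. For other n, (X - 2) S_q(C_N) with q = ⌊n/N⌋ is orthogonal to every row. -/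

open Polynomial LaurentPolynomial in
/-- Substitution of `x + x⁻¹` for the variable. -/
noncomputable def joukowsky : ℤ[X] →ₐ[ℤ] ℤ[T;T⁻¹] := aeval (T 1 + T (-1))

open Polynomial LaurentPolynomial in
/-- The linear functional sending `p` to the constant term of `f(x) p(x + x⁻¹)`. -/
noncomputable def constTerm (f : ℤ[T;T⁻¹]) : ℤ[X] →ₗ[ℤ] ℤ where
  toFun p := (f * joukowsky p).coeff 0
  map_add' p q := by simp [mul_add]
  map_smul' c p := by
    rw [map_smul, mul_smul_comm, AddMonoidAlgebra.coeff_smul]; rfl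

open LaurentPolynomial in
/-- The Laurent polynomial `x^(1-M) + ... + x^M`. -/
noncomputable def centralSum (M : ℕ) : ℤ[T;T⁻¹] :=
  ∑ l ∈ Finset.Icc (1 - (M : ℤ)) M, T l

open LaurentPolynomial Polynomial in
/-- The constant term functional with weight `(x - x⁻¹) x^M`. -/
noncomputable def skewTerm (M : ℤ) : ℤ[X] →ₗ[ℤ] ℤ :=
  constTerm ((T 1 - T (-1)) * T M)

/-! ### Symmetry and vanishing of the skew functional. -/

namespace ConstTerm

open Polynomial LaurentPolynomial

lemma constTerm_apply (f : ℤ[T;T⁻¹]) (p : ℤ[X]) :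
    constTerm f p = (f * joukowsky p).coeff 0 := rfl

lemma constTerm_add (f g : ℤ[T;T⁻¹]) (p : ℤ[X]) :
    constTerm (f + g) p = constTerm f p + constTerm g p := by
  simp [constTerm_apply, add_mul]

lemma constTerm_sub (f g : ℤ[T;T⁻¹]) (p : ℤ[X]) :
    constTerm (f - g) p = constTerm f p - constTerm g p := by
  simp [constTerm_apply, sub_mul]

lemma constTerm_mul (f : ℤ[T;T⁻¹]) (q p : ℤ[X]) :
    constTerm f (q * p) = constTerm (f * joukowsky q) p := by
  simp [constTerm_apply, mul_assoc]

lemma joukowsky_X : joukowsky X = T 1 + T (-1) := by simp [joukowsky]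

lemma invert_joukowsky (p : ℤ[X]) : invert (joukowsky p) = joukowsky p := by
  have h : (invert (R := ℤ)).toAlgHom.comp joukowsky = joukowsky := by
    apply Polynomial.algHom_ext
    simp [joukowsky_X, add_comm]
  exact DFunLike.congr_fun h p

lemma constTerm_invert (f : ℤ[T;T⁻¹]) (p : ℤ[X]) :
    constTerm (invert f) p = constTerm f p := by
  have h : invert f * joukowsky p = invert (f * joukowsky p) := by
    rw [map_mul, invert_joukowsky]
  rw [constTerm_apply, h, invert_apply, neg_zero, constTerm_apply]

/-- Inverting x preserves constant terms and p(x + x⁻¹) but negates x - x⁻¹. -/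
lemma skewTerm_neg (M : ℤ) (p : ℤ[X]) : skewTerm (-M) p = -skewTerm M p := by
  have h : (T 1 - T (-1)) * T (-M) = -invert ((T 1 - T (-1)) * T M : ℤ[T;T⁻¹]) := by
    simp only [map_mul, map_sub, invert_T, neg_neg]; ring
  have h2 := constTerm_sub 0 (invert ((T 1 - T (-1)) * T M : ℤ[T;T⁻¹])) p
  rw [skewTerm, h, ← zero_sub, h2, constTerm_invert]
  simp [constTerm_apply, skewTerm]

lemma skewTerm_zero (p : ℤ[X]) : skewTerm 0 p = 0 := by
  have := skewTerm_neg 0 p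
  simp only [neg_zero] at this
  omega

lemma joukowsky_C (m : ℤ) : joukowsky (Chebyshev.C ℤ m) = T m + T (-m) := by
  induction m using Polynomial.Chebyshev.induct with
  | zero => rw [Chebyshev.C_zero, map_ofNat, neg_zero, T_zero, one_add_one_eq_two]
  | one => simp [joukowsky_X]
  | add_two n ih1 ih2 =>
    rw [Chebyshev.C_add_two, map_sub, map_mul, ih1, ih2, joukowsky_X]
    simp only [add_mul, mul_add, ← T_add]
    ring_nf
  | neg_add_one n ih1 ih2 =>
    rw [Chebyshev.C_sub_one, map_sub, map_mul, ih1, ih2, joukowsky_X]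
    simp only [add_mul, mul_add, ← T_add]
    ring_nf

lemma skewTerm_C_mul (M m : ℤ) (p : ℤ[X]) :
    skewTerm M (Chebyshev.C ℤ m * p) = skewTerm (M + m) p + skewTerm (M - m) p := by
  rw [skewTerm, constTerm_mul, joukowsky_C, skewTerm, skewTerm, ← constTerm_add]
  congr 2
  rw [T_add, sub_eq_add_neg M, T_add]; ring

lemma skewTerm_X_mul (M : ℤ) (p : ℤ[X]) :
    skewTerm M (X * p) = skewTerm (M + 1) p + skewTerm (M - 1) p := by
  simpa using skewTerm_C_mul M 1 p

lemma skewTerm_one (M : ℤ) (hM : 0 < M) : skewTerm M 1 = if M = 1 then -1 else 0 := by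
  rw [skewTerm, constTerm_apply, map_one, mul_one, sub_mul, ← T_add, ← T_add]
  simp only [AddMonoidAlgebra.coeff_sub, Finsupp.sub_apply, T_apply]
  split_ifs <;> omega

/-- The lowest term of (x - x⁻¹)x^M is -x^(M-1), while the highest power x^j of (x + x⁻¹)^j pairs
only with x^(-j): for M > j only the lowest term of the product can reach degree 0. -/
lemma skewTerm_X_pow (j : ℕ) (M : ℤ) (h : j < M) :
    skewTerm M (X ^ j) = if M = j + 1 then -1 else 0 := by
  induction j generalizing M with
  | zero => simpa using skewTerm_one M (by simpa using h)
  | succ j ih =>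
    push_cast at h ⊢
    rw [pow_succ', skewTerm_X_mul, ih _ (by omega), ih _ (by omega)]
    split_ifs <;> omega

lemma skewTerm_of_natDegree_lt (p : ℤ[X]) (M : ℤ) (h : p.natDegree + 1 < M) :
    skewTerm M p = 0 := by
  rw [p.as_sum_range_C_mul_X_pow, map_sum]
  refine Finset.sum_eq_zero fun j hj => ?_
  have hj := Finset.mem_range.1 hj
  rw [← Polynomial.smul_eq_C_mul, map_smul, skewTerm_X_pow _ _ (by omega), if_neg (by omega), smul_zero]

lemma skewTerm_of_monic (p : ℤ[X]) (hp : p.Monic) (M : ℤ) (h : p.natDegree + 1 = M) :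
    skewTerm M p = -1 := by
  rw [p.as_sum_range_C_mul_X_pow, map_sum, Finset.sum_range_succ, Finset.sum_eq_zero]
  · rw [← Polynomial.smul_eq_C_mul, map_smul, skewTerm_X_pow _ _ (by omega), if_pos h.symm,
      hp.coeff_natDegree]
    simp
  · intro j hj
    have hj := Finset.mem_range.1 hj
    rw [← Polynomial.smul_eq_C_mul, map_smul, skewTerm_X_pow _ _ (by omega), if_neg (by omega), smul_zero]

/-! ### Composed Chebyshev polynomials under the two constant term functionals. -/

/-- The Chebyshev polynomial of the second kind `S_a`, evaluated at the Chebyshev polynomial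
of the first kind `C_N`. -/
noncomputable def chebS (N a : ℕ) : ℤ[X] := (Chebyshev.S ℤ a).comp (Chebyshev.C ℤ N)

lemma chebS_zero (N : ℕ) : chebS N 0 = 1 := by simp [chebS]

lemma chebS_one (N : ℕ) : chebS N 1 = Chebyshev.C ℤ N := by simp [chebS]

lemma chebS_add_two (N a : ℕ) :
    chebS N (a + 2) = Chebyshev.C ℤ N * chebS N (a + 1) - chebS N a := by
  simp only [chebS]
  push_cast
  rw [Chebyshev.S_add_two]
  simp

/-- A factor C_N shifts the exponent by ±N, so both sides satisfy the recurrence of S_a in a;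
`skewTerm 0 = 0` supplies the initial condition. -/
lemma skewTerm_chebS_mul (N a : ℕ) (p : ℤ[X]) :
    skewTerm N (chebS N a * p) = skewTerm (N * (a + 1)) p := by
  induction a using Nat.twoStepInduction generalizing p with
  | zero => simp [chebS_zero]
  | one =>
    rw [chebS_one, skewTerm_C_mul, sub_self, skewTerm_zero]
    push_cast; ring_nf
  | more a ih1 ih2 =>
    have h : chebS N (a + 2) * p
        = chebS N (a + 1) * (Chebyshev.C ℤ N * p) - chebS N a * p := by
      rw [chebS_add_two]; ring
    rw [h, map_sub, ih2, ih1, skewTerm_C_mul]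
    push_cast; ring_nf

lemma centralSum_zero : centralSum 0 = 0 := by simp [centralSum]

/-- The geometric series; identities between central sums are checked after multiplication by x - 1.
-/
lemma centralSum_mul (M : ℕ) :
    centralSum M * (T 1 - 1) = T (M + 1) - T (1 - M) := by
  induction M with
  | zero => simp [centralSum_zero]
  | succ M ih =>
    have h : centralSum (M + 1) = T (-(M : ℤ)) + centralSum M + T (M + 1) := by
      have e : Finset.Icc (1 - ((M + 1 : ℕ) : ℤ)) ((M + 1 : ℕ) : ℤ)
          = insert (-(M : ℤ)) (insert ((M : ℤ) + 1) (Finset.Icc (1 - (M : ℤ)) M)) := by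
        ext l; simp only [Finset.mem_Icc, Finset.mem_insert]; push_cast; omega
      rw [centralSum, e, Finset.sum_insert, Finset.sum_insert, centralSum]
      · ring
      · simp
      · simp only [Finset.mem_Icc, Finset.mem_insert]; omega
    rw [h, add_mul, add_mul, ih]
    simp only [mul_sub, mul_one, ← T_add]
    push_cast
    ring_nf

lemma T_one_sub_one_ne_zero : (T 1 - 1 : ℤ[T;T⁻¹]) ≠ 0 := by
  intro h
  have := congrArg (fun f : ℤ[T;T⁻¹] => f.coeff 1) h
  rw [← T_zero, AddMonoidAlgebra.coeff_sub, Finsupp.sub_apply, T_apply, T_apply] at this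
  simp at this

lemma centralSum_mul_T (M N : ℕ) :
    centralSum (M + N) * (T N + T (-N)) = centralSum (M + 2 * N) + centralSum M := by
  apply mul_right_cancel₀ T_one_sub_one_ne_zero
  rw [add_mul, mul_right_comm, centralSum_mul, centralSum_mul, centralSum_mul]
  simp only [sub_mul, mul_add, ← T_add]
  push_cast
  ring_nf

/-- The same recurrence as for `skewTerm_chebS_mul`, now started by `centralSum 0 = 0`. -/
lemma constTerm_centralSum_chebS_mul (N a : ℕ) (p : ℤ[X]) :
    constTerm (centralSum N) (chebS N a * p) = constTerm (centralSum (N * (a + 1))) p := by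
  induction a using Nat.twoStepInduction generalizing p with
  | zero => simp [chebS_zero]
  | one =>
    have := centralSum_mul_T 0 N
    rw [zero_add, zero_add, centralSum_zero, add_zero] at this
    rw [chebS_one, constTerm_mul, joukowsky_C, this]
    ring_nf
  | more a ih1 ih2 =>
    have h : chebS N (a + 2) * p
        = chebS N (a + 1) * (Chebyshev.C ℤ N * p) - chebS N a * p := by
      rw [chebS_add_two]; ring
    rw [h, map_sub, ih2, ih1, constTerm_mul, joukowsky_C]
    have := centralSum_mul_T (N * (a + 1)) N
    rw [show N * (a + 1 + 1) = N * (a + 1) + N by ring, this, constTerm_add]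
    ring_nf

lemma constTerm_T (l : ℤ) : constTerm (T l) 1 = if l = 0 then 1 else 0 := by
  simp [constTerm_apply]

lemma constTerm_centralSum (M : ℕ) (p : ℤ[X]) :
    constTerm (centralSum M) p = ∑ l ∈ Finset.Icc (1 - (M : ℤ)) M, constTerm (T l) p := by
  simp [constTerm_apply, centralSum, Finset.sum_mul]

lemma constTerm_centralSum_one (M : ℕ) (hM : 0 < M) : constTerm (centralSum M) 1 = 1 := by
  simp only [constTerm_centralSum, constTerm_T, Finset.sum_ite_eq', Finset.mem_Icc]
  rw [if_pos (by omega)]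

lemma constTerm_centralSum_X (M : ℕ) (hM : 1 < M) : constTerm (centralSum M) X = 2 := by
  have h (l : ℤ) : constTerm (T l) X
      = (if l = -1 then 1 else 0) + (if l = 1 then 1 else 0) := by
    rw [constTerm_apply, joukowsky_X, mul_add, ← T_add, ← T_add]
    simp only [AddMonoidAlgebra.coeff_add, Finsupp.add_apply, T_apply]
    congr 2 <;> apply propext <;> omega
  simp only [constTerm_centralSum, h, Finset.sum_add_distrib, Finset.sum_ite_eq', Finset.mem_Icc]
  rw [if_pos (by omega), if_pos (by omega)]
  rfl

/-- The value does not depend on a, so differences of composed Chebyshev polynomials are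
annihilated. -/
lemma constTerm_centralSum_chebS (N a : ℕ) (hN : 0 < N) :
    constTerm (centralSum N) (chebS N a) = 1 := by
  have := constTerm_centralSum_chebS_mul N a 1
  rwa [mul_one, constTerm_centralSum_one _ (by positivity)] at this

lemma constTerm_centralSum_X_sub_two_mul_chebS (N a : ℕ) (hN : 1 < N) :
    constTerm (centralSum N) ((X - 2) * chebS N a) = 0 := by
  have h2 : (2 : ℤ[X]) = (2 : ℤ) • 1 := by simp
  rw [mul_comm, constTerm_centralSum_chebS_mul, map_sub, h2, map_smul,
    constTerm_centralSum_one _ (by positivity), constTerm_centralSum_X _ (by nlinarith)]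
  norm_num

/-- C_N(-2) = 2(-1)^N and S_a(±2) = (±1)^a (a + 1). -/
lemma eval_chebS (N a : ℕ) : (chebS N a).eval (-2) = (-1) ^ (N * a) * (a + 1) := by
  rw [chebS, eval_comp, Chebyshev.C_eval_neg_two]
  rcases Nat.even_or_odd N with h | h
  · have : (Int.negOnePow N : ℤ) = 1 := by
      rw [Int.negOnePow_even _ (by exact_mod_cast h)]; rfl
    rw [Int.cast_id, this, mul_one, Chebyshev.S_eval_two, pow_mul, h.neg_one_pow]; simp
  · have : (Int.negOnePow N : ℤ) = -1 := by
      rw [Int.negOnePow_odd _ (by exact_mod_cast h)]; rfl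
    rw [Int.cast_id, this, mul_neg, mul_one, Chebyshev.S_eval_neg_two, pow_mul, h.neg_one_pow]
    rcases Nat.even_or_odd a with h' | h'
    · rw [Int.negOnePow_even _ (by exact_mod_cast h'), h'.neg_one_pow]; simp
    · rw [Int.negOnePow_odd _ (by exact_mod_cast h'), h'.neg_one_pow]; simp

lemma monic_S (a : ℕ) :
    (Chebyshev.S ℤ a).Monic ∧ (Chebyshev.S ℤ a).natDegree = a := by
  induction a using Nat.twoStepInduction with
  | zero => simp
  | one => simp [monic_X]
  | more a ih1 ih2 =>
    have e : Chebyshev.S ℤ ((a + 2 : ℕ) : ℤ)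
        = X * Chebyshev.S ℤ ((a + 1 : ℕ) : ℤ) - Chebyshev.S ℤ a := by
      push_cast; rw [Chebyshev.S_add_two]
    have hm := monic_X.mul ih2.1
    have hd : (X * Chebyshev.S ℤ ((a + 1 : ℕ) : ℤ)).natDegree = a + 2 := by
      rw [monic_X.natDegree_mul ih2.1, natDegree_X, ih2.2]; ring
    have hlt : (Chebyshev.S ℤ a).natDegree < (X * Chebyshev.S ℤ ((a + 1 : ℕ) : ℤ)).natDegree := by
      omega
    rw [e]
    exact ⟨hm.sub_of_left (degree_lt_degree hlt),
      by rw [natDegree_sub_eq_left_of_natDegree_lt hlt, hd]⟩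

lemma monic_C (N : ℕ) (hN : 0 < N) :
    (Chebyshev.C ℤ N).Monic ∧ (Chebyshev.C ℤ N).natDegree = N := by
  obtain ⟨a, rfl⟩ : ∃ a, N = a + 1 := ⟨N - 1, by omega⟩
  rcases a with _ | a
  · simp [monic_X]
  · have e : Chebyshev.C ℤ ((a + 1 + 1 : ℕ) : ℤ)
        = Chebyshev.S ℤ ((a + 2 : ℕ) : ℤ) - Chebyshev.S ℤ a := by
      rw [Chebyshev.C_eq_S_sub_X_mul_S]
      push_cast
      rw [add_assoc, one_add_one_eq_two, Chebyshev.S_add_two]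
      ring_nf
    have hlt : (Chebyshev.S ℤ a).natDegree < (Chebyshev.S ℤ ((a + 2 : ℕ) : ℤ)).natDegree := by
      rw [(monic_S _).2, (monic_S _).2]; omega
    rw [e]
    exact ⟨(monic_S _).1.sub_of_left (degree_lt_degree hlt),
      by rw [natDegree_sub_eq_left_of_natDegree_lt hlt, (monic_S _).2]⟩

lemma monic_chebS (N a : ℕ) (hN : 0 < N) : (chebS N a).Monic :=
  (monic_S a).1.comp (monic_C N hN).1 (by rw [(monic_C N hN).2]; omega)

lemma natDegree_chebS (N a : ℕ) (hN : 0 < N) : (chebS N a).natDegree = N * a := by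
  rw [chebS, natDegree_comp, (monic_S a).2, (monic_C N hN).2, mul_comm]

/-! ### The binomial sums as moments. -/

/-- The functional whose moments at the powers of `X + 2` are the entries of `binomSumHankel`. -/
noncomputable def hankelFunctional (N : ℕ) : ℤ[X] →ₗ[ℤ] ℤ :=
  constTerm (centralSum N * (T 1 + T (-1) + 2))

lemma constTerm_centralSum_X_add_two_mul (N : ℕ) (p : ℤ[X]) :
    constTerm (centralSum N) ((X + 2) * p) = hankelFunctional N p := by
  rw [constTerm_mul, map_add, joukowsky_X, map_ofNat, hankelFunctional]

/-- The product (x + x⁻¹ + 2)(x + x⁻¹ - 2) = (x - x⁻¹)² contains the factor x - 1 that sums the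
geometric series. What remains is (x - x⁻¹)(x^(N+1) + x^N - x^(1-N) - x^(-N)), and antisymmetry in
the exponent folds the last two terms onto the exponents N - 1 and N. -/
lemma hankelFunctional_X_sub_two_mul (N : ℕ) (p : ℤ[X]) :
    hankelFunctional N ((X - 2) * p) = skewTerm N ((X + 2) * p) := by
  have hX : skewTerm N ((X + 2) * p)
      = skewTerm (N + 1) p + skewTerm (N - 1) p + 2 * skewTerm N p := by
    rw [add_mul, map_add, skewTerm_X_mul, show (2 : ℤ[X]) * p = (2 : ℤ) • p by
      rw [Polynomial.smul_eq_C_mul]; rfl, map_smul, smul_eq_mul]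
  have key : centralSum N * (T 1 + T (-1) + 2) * (T 1 + T (-1) - 2)
      = (T 1 - T (-1)) * T (N + 1) + (T 1 - T (-1)) * T N - (T 1 - T (-1)) * T (-(N - 1))
        - (T 1 - T (-1)) * T (-N) := by
    have h1 : (T 1 + T (-1) + 2) * (T 1 + T (-1) - 2)
        = (T 1 - T (-1)) * (T (-1) + 1) * (T 1 - 1 : ℤ[T;T⁻¹]) := by
      have : T 1 * T (-1) = (1 : ℤ[T;T⁻¹]) := by rw [← T_add]; simp
      linear_combination (4 - T 1 + T (-1)) * this
    rw [mul_assoc, h1, mul_comm _ (T 1 - 1), ← mul_assoc, centralSum_mul]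
    simp only [sub_mul, mul_sub, mul_add, mul_one, ← T_add]
    ring_nf
  rw [hankelFunctional, constTerm_mul, map_sub, joukowsky_X, map_ofNat, key, constTerm_sub,
    constTerm_sub, constTerm_add, hX]
  have e1 := skewTerm_neg N p
  have e2 := skewTerm_neg (N - 1) p
  simp only [skewTerm] at *
  rw [e1, e2]; ring

lemma constTerm_T_X_add_two_pow (l : ℤ) (M : ℕ) :
    constTerm (T l) ((X + 2) ^ M) = intBinom (2 * M) (M + l) := by
  have h1 : joukowsky (X + 2) = T (-1) * (T 1 + 1) ^ 2 := by
    rw [map_add, joukowsky_X, map_ofNat]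
    have : T 1 * T (-1) = (1 : ℤ[T;T⁻¹]) := by rw [← T_add]; simp
    linear_combination (-T 1 - 2) * this
  have h2 : constTerm (T l) ((X + 2) ^ M)
      = ∑ j ∈ Finset.range (2 * M + 1), if (j : ℤ) = M + l then ((2 * M).choose j : ℤ) else 0 := by
    -- Inverting T l first makes the surviving binomial index M + l instead of M - l.
    rw [← constTerm_invert, invert_T, constTerm_apply, map_pow, h1, mul_pow, ← pow_mul, add_pow,
      Finset.mul_sum, Finset.mul_sum, AddMonoidAlgebra.coeff_sum, Finset.sum_apply']
    refine Finset.sum_congr rfl fun j _ => ?_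
    have : (T (-l) : ℤ[T;T⁻¹]) * (T (-1) ^ M * (T 1 ^ j * 1 ^ (2 * M - j) * ((2 * M).choose j : ℤ[T;T⁻¹])))
        = LaurentPolynomial.C ((2 * M).choose j : ℤ) * T (j - (M + l)) := by
      rw [T_pow, T_pow, one_pow, mul_one, map_natCast, mul_comm _ (T _), ← mul_assoc, ← mul_assoc,
        ← T_add, ← T_add]
      congr 2; ring
    rw [this, ← single_eq_C_mul_T, AddMonoidAlgebra.coeff_single, Finsupp.single_apply]
    congr 1
    apply propext; omega
  rw [h2, intBinom]
  split_ifs with h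
  · rw [Finset.sum_congr rfl (g := fun j => if j = (M + l).toNat then ((2 * M).choose j : ℤ) else 0)
      (fun j _ => by congr 1; apply propext; omega), Finset.sum_ite_eq']
    split_ifs with h'
    · rfl
    · rw [Nat.choose_eq_zero_of_lt]
      · rfl
      · rw [Finset.mem_range] at h'; omega
  · exact Finset.sum_eq_zero fun j _ => if_neg (by omega)

lemma binomSumHankel_apply (k n : ℕ) (i j : Fin n) :
    binomSumHankel k n i j
      = hankelFunctional (k + 1) ((X + 2) ^ (i : ℕ) * (X + 2) ^ (j : ℕ)) := by
  rw [← constTerm_centralSum_X_add_two_mul, ← pow_add, ← pow_succ', constTerm_centralSum,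
    binomSumHankel, Matrix.of_apply]
  -- With N = k + 1, the range 1 - N ≤ l ≤ N is -k ≤ l ≤ k + 1.
  refine Finset.sum_congr (by push_cast; congr 1; ring) fun l _ => ?_
  rw [constTerm_T_X_add_two_pow]
  push_cast
  congr 1 <;> ring

end ConstTerm

/-! ### Determinants: change of monic basis, antitriangular and block triangular shapes. -/

namespace Matrix

open Polynomial

/-- Replacing the powers of `X` by monic polynomials of the same degrees does not change the
determinant formed with linear functionals. -/
lemma det_functional_monic {m : ℕ} (φ : Fin m → (ℤ[X] →ₗ[ℤ] ℤ)) (r : ℕ → ℤ[X])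
    (hm : ∀ j < m, (r j).Monic) (hd : ∀ j < m, (r j).natDegree = j) :
    (of fun i j : Fin m => φ i (r j)).det = (of fun i j : Fin m => φ i (X ^ (j : ℕ))).det := by
  have h : (of fun i j : Fin m => φ i (r j))
      = (of fun i j : Fin m => φ i (X ^ (j : ℕ))) *
        (of fun i j : Fin m => (r j).coeff i) := by
    ext i j
    rw [mul_apply, of_apply, (r j).as_sum_range' m (by rw [hd _ j.2]; exact j.2), map_sum,
      Finset.sum_range]
    refine Finset.sum_congr rfl fun t _ => ?_
    rw [← C_mul_X_pow_eq_monomial, ← Polynomial.smul_eq_C_mul, map_smul, smul_eq_mul, mul_comm]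
    rfl
  rw [h, det_mul, det_matrixOfPolynomials (fun j : Fin m => r j) (fun j => hd _ j.2)
    (fun j => hm _ j.2), mul_one]

/-- The moment determinant of a functional can be computed with any two monic bases. -/
lemma det_moment_monic {m : ℕ} (φ : ℤ[X] →ₗ[ℤ] ℤ) (p r : ℕ → ℤ[X])
    (hpm : ∀ j < m, (p j).Monic) (hpd : ∀ j < m, (p j).natDegree = j)
    (hm : ∀ j < m, (r j).Monic) (hd : ∀ j < m, (r j).natDegree = j) :
    (of fun i j : Fin m => φ (p i * r j)).det
      = (of fun i j : Fin m => φ (X ^ (i : ℕ) * X ^ (j : ℕ))).det := by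
  have h1 := det_functional_monic (fun i : Fin m => φ ∘ₗ LinearMap.mulLeft ℤ (p i)) r hm hd
  have h2 := det_functional_monic
    (fun i : Fin m => φ ∘ₗ LinearMap.mulLeft ℤ (X ^ (i : ℕ))) p hpm hpd
  simp only [LinearMap.comp_apply, LinearMap.mulLeft_apply] at h1 h2
  rw [h1, ← h2, ← det_transpose]
  congr 1
  ext i j
  simp [mul_comm]

/-- The determinant of the leading `m × m` block of an infinite array. -/
def natDet (m : ℕ) (F : ℕ → ℕ → ℤ) : ℤ := (of fun i j : Fin m => F i j).det

lemma natDet_antitriangular (g : ℕ) (F : ℕ → ℕ → ℤ) (h : ∀ i j, i + j + 1 < g → F i j = 0) :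
    natDet g F = (-1) ^ g.choose 2 * ∏ i ∈ Finset.range g, F i (g - 1 - i) := by
  induction g generalizing F with
  | zero => simp [natDet]
  | succ g ih =>
    have h1 : natDet (g + 1) F = (-1) ^ g * F 0 g * natDet g (fun i j => F (i + 1) j) := by
      rw [natDet, det_succ_row_zero, Finset.sum_eq_single (Fin.last g)]
      · rw [Fin.succAbove_last]; rfl
      · intro j _ hj
        have hj' : (j : ℕ) < g := Fin.val_lt_last hj
        have : F 0 j = 0 := h _ _ (by omega)
        simp [this]
      · simp
    rw [h1, ih _ (fun i j hij => h _ _ (by omega)), Finset.prod_range_succ',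
      Nat.choose_succ_succ' g 1, Nat.choose_one_right, pow_add]
    have : ∀ i, g + 1 - 1 - (i + 1) = g - 1 - i := by intro i; omega
    simp only [this]
    simp only [Nat.add_sub_cancel, Nat.sub_zero]
    ring

lemma natDet_add (g m : ℕ) (F : ℕ → ℕ → ℤ)
    (h : ∀ i < g, ∀ j, g ≤ j → j < g + m → F i j = 0) :
    natDet (g + m) F = natDet g F * natDet m (fun i j => F (g + i) (g + j)) := by
  have e : ((of fun i j : Fin (g + m) => F i j).submatrix finSumFinEquiv finSumFinEquiv)
      = fromBlocks (of fun i j : Fin g => F i j) 0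
        (of fun (i : Fin m) (j : Fin g) => F (g + i) j)
        (of fun i j : Fin m => F (g + i) (g + j)) := by
    ext (i | i) (j | j)
    · simp
    · simpa using h i i.2 (g + j) (by omega) (by omega)
    · simp
    · simp
  rw [natDet, ← det_submatrix_equiv_self finSumFinEquiv, e, det_fromBlocks_zero₁₂]
  rfl

/-- Vanishing is required only to the right of the diagonal blocks, so bordering rows may lie in the
final block of size t with arbitrary entries to its left. -/
lemma natDet_blocks (N q t : ℕ) (F : ℕ → ℕ → ℤ) (c : ℤ)
    (h : ∀ a < q, ∀ i < N, ∀ j, N * (a + 1) ≤ j → j < N * q + t → F (N * a + i) j = 0)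
    (hc : ∀ a < q, natDet N (fun i j => F (N * a + i) (N * a + j)) = c) :
    natDet (N * q + t) F = c ^ q * natDet t (fun i j => F (N * q + i) (N * q + j)) := by
  induction q generalizing F with
  | zero => simp
  | succ q ih =>
    have e : N * (q + 1) + t = N + (N * q + t) := by ring
    rw [e, natDet_add, ih]
    · have h0 := hc 0 (by omega)
      simp only [mul_zero, zero_add] at h0
      rw [h0, pow_succ', mul_assoc]
      simp only [← add_assoc, show N + N * q = N * (q + 1) by ring]
    · intro a ha i hi j hj hj'
      have := h (a + 1) (by omega) i hi (N + j) (by linarith) (by linarith)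
      rwa [show N * (a + 1) + i = N + (N * a + i) by ring] at this
    · intro a ha
      have := hc (a + 1) (by omega)
      simpa only [← add_assoc, show N + N * a = N * (a + 1) by ring] using this
    · intro i hi j hj hj'
      have := h 0 (by omega) i hi j (by linarith) (by linarith)
      simpa using this

/-- A determinant is unchanged when its first two rows are moved, in order, to the bottom. -/
lemma det_cons_cons_eq_snoc_snoc {n : ℕ} (u v : Fin (n + 2) → ℤ) (A : Fin n → Fin (n + 2) → ℤ) :
    (of (Fin.cons u (Fin.cons v A : Fin (n + 1) → Fin (n + 2) → ℤ) :
        Fin (n + 2) → Fin (n + 2) → ℤ)).det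
      = (of (Fin.snoc (Fin.snoc A u : Fin (n + 1) → Fin (n + 2) → ℤ) v :
        Fin (n + 2) → Fin (n + 2) → ℤ)).det := by
  have key (w : Fin (n + 2) → ℤ) (B : Fin (n + 1) → Fin (n + 2) → ℤ) :
      (of (Fin.snoc B w : Fin (n + 2) → Fin (n + 2) → ℤ)).det
        = (-1) ^ (n + 1) * (of (Fin.cons w B : Fin (n + 2) → Fin (n + 2) → ℤ)).det := by
    have := det_permute (finRotate (n + 2))
      (of (Fin.cons w B : Fin (n + 2) → Fin (n + 2) → ℤ))
    rw [sign_finRotate] at this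
    have e : (of (Fin.snoc B w : Fin (n + 2) → Fin (n + 2) → ℤ))
        = (of (Fin.cons w B : Fin (n + 2) → Fin (n + 2) → ℤ)).submatrix (finRotate (n + 2)) id := by
      rw [Fin.snoc_eq_cons_rotate]; rfl
    rw [e, this]
    simp
  have h1 := key u (Fin.cons v A)
  have h2 := key v (Fin.snoc A u)
  rw [← Fin.cons_snoc_eq_snoc_cons] at h1
  rw [h2, h1, ← mul_assoc, ← mul_pow]
  simp

end Matrix

/-! ### The bordered determinant. -/

namespace ConstTerm

open Polynomial LaurentPolynomial Matrix

lemma det_binomSumHankel_eq (k n : ℕ) :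
    (binomSumHankel k n).det
      = (of fun i j : Fin n => hankelFunctional (k + 1) (X ^ (i : ℕ) * X ^ (j : ℕ))).det := by
  have hm (j : ℕ) : ((X + 2 : ℤ[X]) ^ j).Monic := (monic_X_add_C (2 : ℤ)).pow j
  have hd (j : ℕ) : ((X + 2 : ℤ[X]) ^ j).natDegree = j := by
    have := (monic_X_add_C (2 : ℤ)).natDegree_pow j
    rwa [natDegree_X_add_C, mul_one] at this
  rw [← det_moment_monic (hankelFunctional (k + 1)) (fun i => (X + 2) ^ i) (fun i => (X + 2) ^ i)
    (fun j _ => hm j) (fun j _ => hd j) (fun j _ => hm j) (fun j _ => hd j)]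
  congr 1
  ext i j
  exact binomSumHankel_apply k n i j

/-- The functionals `q ↦ skewTerm N (p i * q)` for `i < n`, followed by `u` and `v`. -/
noncomputable def borderRow (N n : ℕ) (p : ℕ → ℤ[X]) (u v : ℤ[X] →ₗ[ℤ] ℤ) (i : ℕ) :
    ℤ[X] →ₗ[ℤ] ℤ :=
  if i < n then skewTerm N ∘ₗ LinearMap.mulLeft ℤ (p i) else if i = n then u else v

lemma borderRow_lt {N n : ℕ} {p : ℕ → ℤ[X]} {u v : ℤ[X] →ₗ[ℤ] ℤ} {i : ℕ} (h : i < n)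
    (q : ℤ[X]) : borderRow N n p u v i q = skewTerm N (p i * q) := by
  simp [borderRow, h]

lemma borderRow_self {N n : ℕ} {p : ℕ → ℤ[X]} {u v : ℤ[X] →ₗ[ℤ] ℤ} :
    borderRow N n p u v n = u := by
  simp [borderRow]

lemma borderRow_gt {N n : ℕ} {p : ℕ → ℤ[X]} {u v : ℤ[X] →ₗ[ℤ] ℤ} {i : ℕ} (h : n < i) :
    borderRow N n p u v i = v := by
  rw [borderRow, if_neg (by omega), if_neg (by omega)]

/-- The moment determinant as a bordered determinant for the weight in which a factor `X + 2`
has replaced a factor `X - 2`. -/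
lemma det_hankelFunctional_eq_border (N n : ℕ) (p r : ℕ → ℤ[X])
    (hpm : ∀ j < n, (p j).Monic) (hpd : ∀ j < n, (p j).natDegree = j)
    (hm : ∀ j < n + 2, (r j).Monic) (hd : ∀ j < n + 2, (r j).natDegree = j) :
    (of fun i j : Fin (n + 1) => hankelFunctional N (X ^ (i : ℕ) * X ^ (j : ℕ))).det
      = natDet (n + 2)
        (fun i j => borderRow N n p (leval (-2)) (constTerm (centralSum N)) i (r j)) := by
  have hX2 : (X - 2 : ℤ[X]).Monic := monic_X_sub_C (2 : ℤ)
  have hX2d : (X - 2 : ℤ[X]).natDegree = 1 := natDegree_X_sub_C (2 : ℤ)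
  have hY2 : (X + 2 : ℤ[X]).Monic := monic_X_add_C (2 : ℤ)
  have hY2d : (X + 2 : ℤ[X]).natDegree = 1 := natDegree_X_add_C (2 : ℤ)
  -- Every row but the first carries the factor X - 2 that converts L into the skew functional.
  let p' : ℕ → ℤ[X] := fun i => Nat.casesOn i 1 (fun i => (X - 2) * p i)
  -- All columns but the first vanish at -2, so the evaluation row is (1, 0, ..., 0) and expanding
  -- along it recovers the moment determinant.
  let c : ℕ → ℤ[X] := fun j => Nat.casesOn j 1 (fun j => (X + 2) * X ^ j)
  have hcm : ∀ j < n + 2, (c j).Monic := by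
    rintro (_ | j) _
    · exact monic_one
    · exact hY2.mul (monic_X_pow j)
  have hcd : ∀ j < n + 2, (c j).natDegree = j := by
    rintro (_ | j) _
    · exact natDegree_one
    · change ((X + 2) * X ^ j : ℤ[X]).natDegree = j + 1
      rw [hY2.natDegree_mul (monic_X_pow j), hY2d, natDegree_X_pow, add_comm]
  rw [← det_moment_monic (hankelFunctional N) p' (fun j => X ^ j)]
  rotate_left
  · rintro (_ | j) hj
    · exact monic_one
    · exact hX2.mul (hpm j (by omega))
  · rintro (_ | j) hj
    · exact natDegree_one
    · change ((X - 2) * p j).natDegree = j + 1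
      rw [hX2.natDegree_mul (hpm j (by omega)), hX2d, hpd j (by omega), add_comm]
  · exact fun j _ => monic_X_pow j
  · exact fun j _ => natDegree_X_pow j
  rw [natDet, det_functional_monic (fun i : Fin (n + 2) => borderRow N n p _ _ i) r hm hd,
    ← det_functional_monic (fun i : Fin (n + 2) => borderRow N n p _ _ i) c hcm hcd]
  have h3 := det_cons_cons_eq_snoc_snoc (fun j : Fin (n + 2) => (c j).eval (-2))
    (fun j => constTerm (centralSum N) (c j)) (fun i : Fin n => fun j => skewTerm N (p i * c j))
  have h4 : (of fun i j : Fin (n + 2) =>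
        borderRow N n p (leval (-2)) (constTerm (centralSum N)) i (c j))
      = of (Fin.snoc (Fin.snoc (fun i : Fin n => fun j => skewTerm N (p i * c j))
        (fun j : Fin (n + 2) => (c j).eval (-2)) : Fin (n + 1) → Fin (n + 2) → ℤ)
        (fun j => constTerm (centralSum N) (c j)) : Fin (n + 2) → Fin (n + 2) → ℤ) := by
    ext i j
    induction i using Fin.lastCases with
    | last =>
      rw [of_apply, of_apply, Fin.snoc_last, borderRow_gt (by simp)]
    | cast i =>
      rw [of_apply, of_apply, Fin.snoc_castSucc]
      induction i using Fin.lastCases with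
      | last =>
        rw [Fin.snoc_last, Fin.val_castSucc, Fin.val_last, borderRow_self, Polynomial.leval_apply]
      | cast i =>
        rw [Fin.snoc_castSucc, Fin.val_castSucc, Fin.val_castSucc, borderRow_lt i.2]
  rw [h4, ← h3]
  symm
  rw [det_succ_row_zero, Finset.sum_eq_single 0]
  · have h0 : (c 0).eval (-2) = 1 := eval_one
    simp only [Fin.val_zero, pow_zero, of_apply, Fin.cons_zero, h0, one_mul, Fin.succAbove_zero]
    symm
    congr 1
    ext i j
    rw [submatrix_apply, of_apply, of_apply, Fin.cons_succ]
    refine Fin.cases ?_ (fun i => ?_) i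
    · rw [Fin.cons_zero]
      change _ = constTerm (centralSum N) ((X + 2) * X ^ (j : ℕ))
      rw [constTerm_centralSum_X_add_two_mul]
      change hankelFunctional N (1 * _) = _
      rw [one_mul]
    · rw [Fin.cons_succ]
      change hankelFunctional N ((X - 2) * p i * X ^ (j : ℕ))
        = skewTerm N (p i * ((X + 2) * X ^ (j : ℕ)))
      rw [mul_assoc, hankelFunctional_X_sub_two_mul]
      congr 1
      ring
  · intro j _ hj
    obtain ⟨j, rfl⟩ := Fin.exists_succ_eq_of_ne_zero hj
    have : (c (j.succ : Fin (n + 2))).eval (-2) = 0 := by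
      change ((X + 2) * X ^ (j : ℕ) : ℤ[X]).eval (-2) = 0
      simp
    rw [of_apply, Fin.cons_zero, this]
    simp
  · simp

lemma natDet_borderRow_sub_smul (N n : ℕ) (p r : ℕ → ℤ[X]) (u v : ℤ[X] →ₗ[ℤ] ℤ) (e : ℤ) :
    natDet (n + 2) (fun i j => borderRow N n p (u - e • v) v i (r j))
      = natDet (n + 2) (fun i j => borderRow N n p u v i (r j)) := by
  have hne : (⟨n, by omega⟩ : Fin (n + 2)) ≠ Fin.last (n + 1) := by simp [Fin.ext_iff]
  have := det_updateRow_add_smul_self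
    (of fun i j : Fin (n + 2) => borderRow N n p u v i (r j)) hne (-e)
  rw [natDet, natDet, ← this]
  congr 1
  ext i j
  rw [updateRow_apply]
  split_ifs with h
  · subst h
    simp [borderRow_self, borderRow_gt (show n < n + 1 by omega), sub_eq_add_neg]
  · have h : (i : ℕ) ≠ n := fun h' => h (Fin.ext h')
    simp [borderRow, h]

lemma natDet_borderRow_swap (N n : ℕ) (p r : ℕ → ℤ[X]) (u v : ℤ[X] →ₗ[ℤ] ℤ) :
    natDet (n + 2) (fun i j => borderRow N n p v u i (r j))
      = -natDet (n + 2) (fun i j => borderRow N n p u v i (r j)) := by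
  have hne : (⟨n, by omega⟩ : Fin (n + 2)) ≠ Fin.last (n + 1) := by simp [Fin.ext_iff]
  have := det_permute (Equiv.swap ⟨n, by omega⟩ (Fin.last (n + 1)))
    (of fun i j : Fin (n + 2) => borderRow N n p u v i (r j))
  rw [Equiv.Perm.sign_swap hne] at this
  rw [Units.val_neg, Units.val_one, Int.cast_neg, Int.cast_one, neg_one_mul] at this
  rw [natDet, natDet, ← this]
  · congr 1
    ext i j
    rw [submatrix_apply, of_apply, of_apply]
    by_cases h1 : i = ⟨n, by omega⟩
    · subst h1
      simp [borderRow_self, borderRow_gt (show n < n + 1 by omega)]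
    · by_cases h2 : i = Fin.last (n + 1)
      · subst h2
        simp [borderRow_self, borderRow_gt (show n < n + 1 by omega)]
      · rw [Equiv.swap_apply_of_ne_of_ne h1 h2]
        have h : (i : ℕ) < n := by
          rw [Fin.ext_iff] at h1 h2
          simp only [Fin.val_last] at h1 h2
          omega
        simp [borderRow_lt h]

/-! ### The block basis for the skew functional. -/

/-- The monic basis `chebS N (j / N) * X ^ (j % N)` of the polynomials, of degrees `0, 1, 2, …`. -/
noncomputable def blockBasis (N j : ℕ) : ℤ[X] := chebS N (j / N) * X ^ (j % N)

lemma blockBasis_mul_add {N i : ℕ} (a : ℕ) (hi : i < N) :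
    blockBasis N (N * a + i) = chebS N a * X ^ i := by
  rw [blockBasis, Nat.mul_add_div (by omega), Nat.div_eq_of_lt hi, Nat.mul_add_mod,
    Nat.mod_eq_of_lt hi, add_zero]

lemma monic_blockBasis {N : ℕ} (hN : 0 < N) (j : ℕ) : (blockBasis N j).Monic :=
  (monic_chebS N _ hN).mul (monic_X_pow _)

lemma natDegree_blockBasis {N : ℕ} (hN : 0 < N) (j : ℕ) : (blockBasis N j).natDegree = j := by
  rw [blockBasis, (monic_chebS N _ hN).natDegree_mul (monic_X_pow _), natDegree_chebS N _ hN,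
    natDegree_X_pow, Nat.div_add_mod]

lemma skewTerm_chebS_mul_eq_zero {N : ℕ} (a : ℕ) (q : ℤ[X])
    (h : q.natDegree + 1 < N * (a + 1)) : skewTerm N (chebS N a * q) = 0 := by
  rw [skewTerm_chebS_mul]
  exact skewTerm_of_natDegree_lt _ _ (by exact_mod_cast h)

lemma skewTerm_blockBasis_mul_eq_zero {N i : ℕ} (a : ℕ) (hi : i < N) (q : ℤ[X])
    (h : i + q.natDegree + 1 < N * (a + 1)) :
    skewTerm N (blockBasis N (N * a + i) * q) = 0 := by
  rw [blockBasis_mul_add a hi, mul_assoc]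
  apply skewTerm_chebS_mul_eq_zero
  refine lt_of_le_of_lt (Nat.add_le_add_right natDegree_mul_le 1) ?_
  rwa [natDegree_X_pow]

/-- The factor of larger index b is the one absorbed into the exponent: N(b + 1) ≥ Na + 2N exceeds
the remaining degree by more than 1. -/
lemma skewTerm_blockBasis_mul_chebS_mul {N i a b : ℕ} (hi : i < N) (hab : a < b) (q : ℤ[X])
    (hq : q.natDegree + i + 1 < 2 * N) :
    skewTerm N (blockBasis N (N * a + i) * (chebS N b * q)) = 0 := by
  have hN : 0 < N := by omega
  rw [mul_left_comm]
  apply skewTerm_chebS_mul_eq_zero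
  refine lt_of_le_of_lt (Nat.add_le_add_right natDegree_mul_le 1) ?_
  rw [natDegree_blockBasis hN]
  have : N * (a + 2) ≤ N * (b + 1) := Nat.mul_le_mul_left _ (by omega)
  nlinarith

lemma skewTerm_blockBasis_mul_of_lt {N i a j : ℕ} (hi : i < N) (hj : N * (a + 1) ≤ j) :
    skewTerm N (blockBasis N (N * a + i) * blockBasis N j) = 0 := by
  have hN : 0 < N := by omega
  have hb : a < j / N := (Nat.le_div_iff_mul_le hN).2 (by rwa [mul_comm])
  have := Nat.mod_lt j hN
  exact skewTerm_blockBasis_mul_chebS_mul hi hb _ (by rw [natDegree_X_pow]; omega)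

lemma skewTerm_blockBasis_mul_self_zero {N i j : ℕ} (a : ℕ) (h : i + j + 1 < N) :
    skewTerm N (blockBasis N (N * a + i) * blockBasis N (N * a + j)) = 0 := by
  apply skewTerm_blockBasis_mul_eq_zero a (by omega)
  rw [natDegree_blockBasis (by omega)]
  linarith

lemma skewTerm_blockBasis_mul_self_antidiag {N i j : ℕ} (a : ℕ) (h : i + j + 1 = N) :
    skewTerm N (blockBasis N (N * a + i) * blockBasis N (N * a + j)) = -1 := by
  have hN : 0 < N := by omega
  rw [blockBasis_mul_add a (by omega), mul_assoc, skewTerm_chebS_mul]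
  apply skewTerm_of_monic
  · exact (monic_X_pow i).mul (monic_blockBasis hN _)
  · rw [(monic_X_pow i).natDegree_mul (monic_blockBasis hN _), natDegree_X_pow,
      natDegree_blockBasis hN]
    push_cast [← h]
    ring

lemma natDet_skewTerm_block (N a : ℕ) (F : ℕ → ℕ → ℤ)
    (hF : ∀ i < N, ∀ j < N,
      F i j = skewTerm N (blockBasis N (N * a + i) * blockBasis N (N * a + j))) :
    natDet N F = (-1) ^ N.choose 2 * (-1) ^ N := by
  rw [natDet_antitriangular]
  · congr 1
    rw [Finset.prod_congr rfl (g := fun _ => (-1 : ℤ)), Finset.prod_const, Finset.card_range]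
    intro i hi
    have hi := Finset.mem_range.1 hi
    rw [hF _ hi _ (by omega), skewTerm_blockBasis_mul_self_antidiag a (by omega)]
  · intro i j hij
    rw [hF _ (by omega) _ (by omega), skewTerm_blockBasis_mul_self_zero a hij]

/-! ### Evaluation in the residue classes modulo N. -/

lemma det_hankelFunctional_mul_succ (k a : ℕ) :
    (of fun i j : Fin ((k + 1) * (a + 1)) =>
        hankelFunctional (k + 1) (X ^ (i : ℕ) * X ^ (j : ℕ))).det
      = ((-1) ^ (k + 1).choose 2 * (-1) ^ (k + 1)) ^ (a + 1)
        * ((-1) ^ ((k + 1) * (a + 1)) * (a + 2) - (-1) ^ ((k + 1) * a) * (a + 1)) := by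
  obtain ⟨N, hNk⟩ : ∃ N, N = k + 1 := ⟨_, rfl⟩
  set n := N * a + k with hn
  have hsize : (k + 1) * (a + 1) = n + 1 := by rw [hn, hNk]; ring
  set r : ℕ → ℤ[X] := fun j => if j = N * (a + 1) then chebS N (a + 1) - chebS N a
    else blockBasis N j with hr
  have hlt : (chebS N a).natDegree < (chebS N (a + 1)).natDegree := by
    rw [natDegree_chebS _ _ (by omega), natDegree_chebS _ _ (by omega)]; nlinarith
  have hrm : ∀ j, (r j).Monic := by
    intro j
    simp only [hr]
    split_ifs
    · exact (monic_chebS _ _ (by omega)).sub_of_left (degree_lt_degree hlt)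
    · exact monic_blockBasis (by omega) j
  have hrd : ∀ j, (r j).natDegree = j := by
    intro j
    simp only [hr]
    split_ifs with h
    · rw [natDegree_sub_eq_left_of_natDegree_lt hlt, natDegree_chebS _ _ (by omega), h]
    · exact natDegree_blockBasis (by omega) j
  have hrb : ∀ j < N * (a + 1), r j = blockBasis N j := fun j hj => if_neg (by omega)
  have hrl : r (N * (a + 1)) = chebS N (a + 1) - chebS N a := if_pos rfl
  have hNa : N * (a + 1) = N * a + N := by ring
  rw [hsize, ← hNk, det_hankelFunctional_eq_border N n (blockBasis N) r
    (fun j _ => monic_blockBasis (by omega) j) (fun j _ => natDegree_blockBasis (by omega) j)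
    (fun j _ => hrm j) (fun j _ => hrd j),
    natDet_borderRow_swap, show n + 2 = N * a + (N + 1) by omega]
  set F : ℕ → ℕ → ℤ := fun i j =>
    borderRow N n (blockBasis N) (constTerm (centralSum N)) (leval (-2)) i (r j) with hF
  have hFlt {i : ℕ} (hi : i < n) (j : ℕ) : F i j = skewTerm N (blockBasis N i * r j) :=
    borderRow_lt hi _
  have hlast : ∀ b ≤ a, ∀ i < N, N * b + i < n → F (N * b + i) (N * (a + 1)) = 0 := by
    intro b hb i hi hbi
    rw [hFlt hbi, hrl, mul_sub, map_sub]
    have h1 := skewTerm_blockBasis_mul_chebS_mul hi (show b < a + 1 by omega) 1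
      (by rw [natDegree_one]; omega)
    rw [mul_one] at h1
    rw [h1, zero_sub, neg_eq_zero, mul_comm]
    apply skewTerm_chebS_mul_eq_zero
    rw [natDegree_blockBasis (by omega)]
    omega
  rw [natDet_blocks N a (N + 1) F ((-1) ^ N.choose 2 * (-1) ^ N), natDet_add]
  · have hcorner : natDet 1 (fun i j => F (N * a + (N + i)) (N * a + (N + j)))
        = (-1) ^ (N * (a + 1)) * (a + 2) - (-1) ^ (N * a) * (a + 1) := by
      have : F (N * a + (N + 0)) (N * a + (N + 0)) = (r (N * (a + 1))).eval (-2) := by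
        simp only [hF]
        rw [borderRow_gt (by omega), Polynomial.leval_apply, hNa]
        rfl
      simp only [natDet, det_unique]
      change F (N * a + (N + 0)) (N * a + (N + 0)) = _
      rw [this, hrl, eval_sub, eval_chebS, eval_chebS]
      push_cast; ring
    have hblock : natDet N (fun i j => F (N * a + i) (N * a + j))
        = (-1) ^ N.choose 2 * (-1) ^ k := by
      rw [natDet_antitriangular]
      · congr 1
        have h0 : F (N * a + k) (N * a + (N - 1 - k)) = 1 := by
          simp only [hF]
          rw [← hn, borderRow_self, hrb _ (by omega), show N * a + (N - 1 - k) = N * a + 0 by omega,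
            blockBasis_mul_add a (by omega), pow_zero, mul_one,
            constTerm_centralSum_chebS _ _ (by omega)]
        rw [hNk, Finset.prod_range_succ, ← hNk, h0, mul_one,
          Finset.prod_congr rfl (g := fun _ => (-1 : ℤ)), Finset.prod_const, Finset.card_range]
        intro i hi
        have hi := Finset.mem_range.1 hi
        rw [hFlt (by omega), hrb _ (by omega),
          skewTerm_blockBasis_mul_self_antidiag a (by omega)]
      · intro i j hij
        rw [hFlt (by omega), hrb _ (by omega), skewTerm_blockBasis_mul_self_zero a hij]
    rw [hcorner, hblock, ← hsize, hNk]
    ring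
  · intro i hi j hj hj'
    obtain rfl : j = N := by omega
    by_cases hik : i < k
    · rw [← hNa]
      exact hlast a le_rfl i hi (by omega)
    · obtain rfl : i = k := by omega
      simp only [hF]
      rw [← hn, borderRow_self, ← hNa, hrl, map_sub, constTerm_centralSum_chebS _ _ (by omega),
        constTerm_centralSum_chebS _ _ (by omega), sub_self]
  · intro b hb i hi j hj hj'
    have hb' : N * (b + 1) ≤ N * a := Nat.mul_le_mul_left _ hb
    have hb2 : N * (b + 1) = N * b + N := by ring
    by_cases hjl : j = N * (a + 1)
    · rw [hjl]
      exact hlast b hb.le i hi (by omega)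
    · rw [hFlt (by omega), hrb _ (by omega), skewTerm_blockBasis_mul_of_lt hi hj]
  · intro b hb
    have hb' : N * (b + 1) ≤ N * a := Nat.mul_le_mul_left _ hb
    have hb2 : N * (b + 1) = N * b + N := by ring
    apply natDet_skewTerm_block N b
    intro i hi j hj
    rw [hFlt (by omega), hrb _ (by omega)]

/-- The final block has size t + 2, with t skew rows above the two border rows. Its antidiagonal
entries in the skew rows are the entries -1 exactly when t + 2 = N; for t = 0 there are no such
rows. -/
lemma det_hankelFunctional_mul_add (N q t : ℕ) (hN : 1 < N) (ht : t = 0 ∨ t + 2 = N) :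
    (of fun i j : Fin (N * q + t + 1) => hankelFunctional N (X ^ (i : ℕ) * X ^ (j : ℕ))).det
      = ((-1) ^ N.choose 2 * (-1) ^ N) ^ q
        * ((-1) ^ (t + 2).choose 2 * ((-1) ^ t * (-4 * ((-1) ^ (N * q) * (q + 1))))) := by
  have htN : t + 2 ≤ N := by omega
  have hX2 : (X - 2 : ℤ[X]).Monic := monic_X_sub_C (2 : ℤ)
  have hX2d : (X - 2 : ℤ[X]).natDegree = 1 := natDegree_X_sub_C (2 : ℤ)
  set n := N * q + t with hn
  -- This column is killed by the central sum row and takes -4 times the value of `chebS N q` at -2.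
  set r : ℕ → ℤ[X] := fun j => if j = N * q + 1 then (X - 2) * chebS N q
    else blockBasis N j with hr
  have hrm : ∀ j, (r j).Monic := by
    intro j
    simp only [hr]
    split_ifs
    · exact hX2.mul (monic_chebS _ _ (by omega))
    · exact monic_blockBasis (by omega) j
  have hrd : ∀ j, (r j).natDegree = j := by
    intro j
    simp only [hr]
    split_ifs with h
    · rw [hX2.natDegree_mul (monic_chebS _ _ (by omega)), natDegree_chebS _ _ (by omega), hX2d, h,
        add_comm]
    · exact natDegree_blockBasis (by omega) j
  have hrb : ∀ j, j ≠ N * q + 1 → r j = blockBasis N j := fun j hj => if_neg hj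
  have hrl : r (N * q + 1) = (X - 2) * chebS N q := if_pos rfl
  rw [det_hankelFunctional_eq_border N n (blockBasis N) r
    (fun j _ => monic_blockBasis (by omega) j) (fun j _ => natDegree_blockBasis (by omega) j)
    (fun j _ => hrm j) (fun j _ => hrd j),
    -- The multiple of the last row is chosen so that the modified evaluation row kills `chebS N q`,
    -- which makes the final block antitriangular.
    ← natDet_borderRow_sub_smul N n _ _ _ _ ((chebS N q).eval (-2)),
    show n + 2 = N * q + (t + 2) by omega]
  set F : ℕ → ℕ → ℤ := fun i j => borderRow N n (blockBasis N)
    (leval (-2) - (chebS N q).eval (-2) • constTerm (centralSum N)) (constTerm (centralSum N))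
    i (r j) with hF
  have hFlt {i : ℕ} (hi : i < n) (j : ℕ) : F i j = skewTerm N (blockBasis N i * r j) :=
    borderRow_lt hi _
  have hr0 : r (N * q + 0) = chebS N q := by
    rw [hrb _ (by omega), blockBasis_mul_add q (by omega), pow_zero, mul_one]
  rw [natDet_blocks N q (t + 2) F ((-1) ^ N.choose 2 * (-1) ^ N), natDet_antitriangular]
  · congr 2
    rw [Finset.prod_range_succ, Finset.prod_range_succ]
    have h1 : F (N * q + t) (N * q + (t + 2 - 1 - t))
        = -4 * ((-1) ^ (N * q) * (q + 1)) := by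
      simp only [hF]
      rw [← hn, borderRow_self, show t + 2 - 1 - t = 1 by omega, hrl, LinearMap.sub_apply,
        LinearMap.smul_apply, constTerm_centralSum_X_sub_two_mul_chebS _ _ hN, Polynomial.leval_apply,
        eval_mul, eval_chebS]
      simp only [eval_sub, eval_X, eval_ofNat, smul_zero]
      ring
    have h2 : F (N * q + (t + 1)) (N * q + (t + 2 - 1 - (t + 1))) = 1 := by
      simp only [hF]
      rw [borderRow_gt (by omega), show t + 2 - 1 - (t + 1) = 0 by omega, hr0,
        constTerm_centralSum_chebS _ _ (by omega)]
    rw [h1, h2, mul_one, Finset.prod_congr rfl (g := fun _ => (-1 : ℤ)), Finset.prod_const,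
      Finset.card_range]
    intro i hi
    have hi := Finset.mem_range.1 hi
    rw [hFlt (by omega), hrb _ (by omega), skewTerm_blockBasis_mul_self_antidiag q (by omega)]
  · intro i j hij
    by_cases hi : i < t
    · rw [hFlt (by omega)]
      apply skewTerm_blockBasis_mul_eq_zero q (by omega)
      rw [hrd, mul_add]
      omega
    · obtain ⟨rfl, rfl⟩ : i = t ∧ j = 0 := by omega
      simp only [hF]
      rw [← hn, borderRow_self, hr0, LinearMap.sub_apply, LinearMap.smul_apply,
        constTerm_centralSum_chebS _ _ (by omega), Polynomial.leval_apply]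
      simp
  · intro b hb i hi j hj hj'
    have hb' : N * (b + 1) ≤ N * q := Nat.mul_le_mul_left _ hb
    have hb2 : N * (b + 1) = N * b + N := by ring
    rw [hFlt (by omega)]
    by_cases hjl : j = N * q + 1
    · rw [hjl, hrl, mul_comm (X - 2)]
      exact skewTerm_blockBasis_mul_chebS_mul hi hb _ (by omega)
    · rw [hrb _ hjl, skewTerm_blockBasis_mul_of_lt hi hj]
  · intro b hb
    have hb' : N * (b + 1) ≤ N * q := Nat.mul_le_mul_left _ hb
    have hb2 : N * (b + 1) = N * b + N := by ring
    apply natDet_skewTerm_block N b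
    intro i hi j hj
    rw [hFlt (by omega), hrb _ (by omega)]

/-- The polynomial (X - 2) S_q(C_N) has degree Nq + 1, which is a column index since s ≥ 2. It is
L-orthogonal to X^i for i + 2 < N(q + 1), which covers all rows since s + 2 ≤ N. -/
lemma det_hankelFunctional_eq_zero (N q s : ℕ) (hs : 2 ≤ s) (hsN : s + 2 ≤ N) :
    (of fun i j : Fin (N * q + s) =>
      hankelFunctional N (X ^ (i : ℕ) * X ^ (j : ℕ))).det = 0 := by
  have hX2 : (X - 2 : ℤ[X]).Monic := monic_X_sub_C (2 : ℤ)
  have hX2d : (X - 2 : ℤ[X]).natDegree = 1 := natDegree_X_sub_C (2 : ℤ)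
  have hP := hX2.mul (monic_chebS N q (by omega))
  have hPd : ((X - 2) * chebS N q).natDegree = N * q + 1 := by
    rw [hX2.natDegree_mul (monic_chebS _ _ (by omega)), natDegree_chebS _ _ (by omega), hX2d,
      add_comm]
  rw [← det_moment_monic (hankelFunctional N) (fun i => X ^ i)
    (fun j => if j = N * q + 1 then (X - 2) * chebS N q else X ^ j)
    (fun j _ => monic_X_pow j) (fun j _ => natDegree_X_pow j)]
  · apply det_eq_zero_of_column_eq_zero ⟨N * q + 1, by omega⟩
    intro i
    have e : (X + 2) * (X ^ (i : ℕ) * chebS N q) = chebS N q * ((X + 2) * X ^ (i : ℕ)) := by ring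
    rw [of_apply, if_pos rfl, mul_left_comm, hankelFunctional_X_sub_two_mul, e]
    apply skewTerm_chebS_mul_eq_zero
    refine lt_of_le_of_lt (Nat.add_le_add_right natDegree_mul_le 1) ?_
    rw [natDegree_X_pow, show (X + 2 : ℤ[X]).natDegree = 1 from natDegree_X_add_C (2 : ℤ)]
    have := i.2
    rw [mul_add]
    omega
  · intro j _
    split_ifs
    · exact hP
    · exact monic_X_pow j
  · intro j _
    split_ifs with h
    · rw [hPd, h]
    · exact natDegree_X_pow j

end ConstTerm

/-! ### Assembly of the cases and comparison of signs. -/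

open ConstTerm in
theorem corollary18 (n k : ℕ) (hn : 0 < n) :
    (∀ n₁ : ℕ, n = (k + 1) * n₁ → Even k →
      (binomSumHankel k n).det = (-1) ^ (n₁ * (k + 1).choose 2) * (2 * (n₁ : ℤ) + 1)) ∧
    (∀ n₁ : ℕ, n = (k + 1) * n₁ → Odd k →
      (binomSumHankel k n).det = (-1) ^ (n₁ * (k + 1).choose 2)) ∧
    (∀ n₁ : ℕ, k ≠ 0 → n = (k + 1) * n₁ + 1 →
      (binomSumHankel k n).det = (-1) ^ (n₁ * (k + 1).choose 2) * (4 * (n₁ : ℤ) + 4)) ∧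
    (∀ n₁ : ℕ, k ≠ 0 → n = (k + 1) * n₁ + k →
      (binomSumHankel k n).det =
        (-1) ^ ((n₁ + 1) * (k + 1).choose 2 + k) * (4 * (n₁ : ℤ) + 4)) ∧
    (¬ n ≡ 0 [MOD k + 1] → ¬ n ≡ 1 [MOD k + 1] → ¬ n ≡ k [MOD k + 1] →
      (binomSumHankel k n).det = 0) := by
  have hsq (m : ℕ) : ((-1 : ℤ) ^ m) * (-1) ^ m = 1 := by rw [← mul_pow]; simp
  refine ⟨fun n₁ h hk => ?_, fun n₁ h hk => ?_, fun n₁ hk h => ?_, fun n₁ hk h => ?_,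
    fun h0 h1 hk => ?_⟩
  -- Positivity of n excludes n₁ = 0.
  · obtain ⟨a, rfl⟩ : ∃ a, n₁ = a + 1 := ⟨n₁ - 1, by rcases n₁ with _ | _ <;> simp_all⟩
    subst h
    rw [det_binomSumHankel_eq, det_hankelFunctional_mul_succ, mul_pow, ← pow_mul, ← pow_mul,
      mul_comm ((k + 1).choose 2)]
    have e1 : (-1 : ℤ) ^ ((k + 1) * a) = (-1) ^ a := by
      rw [pow_mul, hk.add_one.neg_one_pow]
    have e2 : (-1 : ℤ) ^ ((k + 1) * (a + 1)) = -(-1) ^ a := by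
      rw [pow_mul, hk.add_one.neg_one_pow, pow_succ]; ring
    rw [e1, e2]
    push_cast
    linear_combination ((-1 : ℤ) ^ ((a + 1) * (k + 1).choose 2) * (2 * a + 3)) * hsq a
  · obtain ⟨a, rfl⟩ : ∃ a, n₁ = a + 1 := ⟨n₁ - 1, by rcases n₁ with _ | _ <;> simp_all⟩
    subst h
    rw [det_binomSumHankel_eq, det_hankelFunctional_mul_succ, mul_pow, ← pow_mul, ← pow_mul,
      mul_comm ((k + 1).choose 2)]
    have e (m : ℕ) : (-1 : ℤ) ^ ((k + 1) * m) = 1 := by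
      rw [pow_mul, hk.add_one.neg_one_pow, one_pow]
    rw [e, e]
    ring
  · subst h
    rw [det_binomSumHankel_eq, show (k + 1) * n₁ + 1 = (k + 1) * n₁ + 0 + 1 by ring,
      det_hankelFunctional_mul_add (k + 1) n₁ 0 (by omega) (Or.inl rfl), mul_pow, ← pow_mul,
      ← pow_mul, mul_comm ((k + 1).choose 2)]
    simp only [zero_add, Nat.choose_self, pow_zero, pow_one]
    linear_combination ((-1 : ℤ) ^ (n₁ * (k + 1).choose 2) * (4 * n₁ + 4)) * hsq ((k + 1) * n₁)
  · subst h
    -- Here N = t + 2, the second alternative of `det_hankelFunctional_mul_add`.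
    obtain ⟨t, rfl⟩ : ∃ t, k = t + 1 := ⟨k - 1, by omega⟩
    rw [det_binomSumHankel_eq, ← add_assoc,
      det_hankelFunctional_mul_add (t + 1 + 1) n₁ t (by omega) (Or.inr rfl), mul_pow, ← pow_mul,
      ← pow_mul, mul_comm ((t + 1 + 1).choose 2), add_mul, one_mul, pow_add, pow_add, pow_succ _ t]
    linear_combination ((-1 : ℤ) ^ (n₁ * (t + 1 + 1).choose 2) * (-1) ^ (t + 1 + 1).choose 2
      * (-1) ^ t * (-4 * n₁ - 4)) * hsq ((t + 1 + 1) * n₁)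
  · have hmod := Nat.mod_lt n (Nat.succ_pos k)
    have hdiv := Nat.div_add_mod n (k + 1)
    set s := n % (k + 1) with hs
    have hs0 : s ≠ 0 := fun h => h0 (by simp [Nat.ModEq, ← hs, h])
    have hsk : s ≠ k := fun h => hk (by
      rw [Nat.ModEq, ← hs, Nat.mod_eq_of_lt (Nat.lt_succ_self k), h])
    have hs1 : s ≠ 1 := fun h => h1 (by
      rw [Nat.ModEq, ← hs, Nat.mod_eq_of_lt (by omega), h])
    rw [det_binomSumHankel_eq, ← hdiv]
    exact det_hankelFunctional_eq_zero (k + 1) _ s (by omega) (by omega)
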